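/- Let $R$ be a commutative noetherian ring, $n\ge 0$, $\mathbf x=(x_1,\dots,x_n)$, and let $R[\![t]\!][\mathbf x]=R[\![t]\!][x_1,\dots,x_n]$. Write its elements as $f=\sum_{\beta,\alpha}c_{\beta,\alpha}\,t^\beta\mathbf x^\alpha$ with $\beta\in\mathbb N$, $\alpha\in\mathbb N^n$; a *monomial of* $f$ is a $t^\beta\mathbf x^\alpha$ with $c_{\beta,\alpha}\neq0$, and the corresponding *term* of $f$ is $c_{\beta,\alpha}t^\beta\mathbf x^\alpha$. An ideal of $R[\![t]\!][\mathbf x]$ is *$\mathbf x$-homogeneous* if it is generated by elements that are homogeneous as polynomials in $\mathbf x$ over $R[\![t]\!]$. Let $>$ be a $t$-local monomial ordering, i.e. a total ordering on the monomials $t^\beta\mathbf x^\alpha$ that is compatible with multiplication and satisfies $1>t$ (it need not be a well-ordering). For $f\ne0$ let $\operatorname{lt}_>(f)\in R[t,\mathbf x]$ be the term of $f$ at its greatest monomial with respect to $>$, put $\operatorname{lt}_>(0)=0$, and let $\operatorname{tail}_>(f)=f-\operatorname{lt}_>(f)$. For a subset $H\subseteq R[\![t]\!][\mathbf x]$, in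 particular for an ideal, let $\operatorname{lt}_>(H)=\langle \operatorname{lt}_>(f)\mid f\in H\rangle\unlhd R[t,\mathbf x]$. For $w=(w_0,\dots,w_n)\in\mathbb R_{<0}\times\mathbb R^n$ let $\operatorname{in}_w(f)\in R[t,\mathbf x]$ be the (finite) sum of those terms $c_{\beta,\alpha}t^\beta\mathbf x^\alpha$ of $f$ for which $w\cdot(\beta,\alpha)$ is maximal, and for an ideal $I\unlhd R[\![t]\!][\mathbf x]$ let $\operatorname{in}_w(I)=\langle \operatorname{in}_w(f)\mid f\in I\rangle\unlhd R[t,\mathbf x]$. A finite subset $G\subseteq I$ is a *standard basis* of $I$ with respect to $>$ if $\operatorname{lt}_>(G)=\operatorname{lt}_>(I)$. It is *initially reduced* if 1. no proper subset of the set $\{\operatorname{lt}_>(g)\mid g\in G\}$ generates $\operatorname{lt}_>(I)$, and 2. for every $g=\sum_\alpha g_\alpha\mathbf x^\alpha\in G$ with $g_\alpha\in R[\![t]\!]$, setting $g'=\sum_\alpha \operatorname{lt}_>(g_\alpha)\,\mathbf x^\alpha$, no term of $\operatorname{tail}_>(g')$ lies in $\operatorname{lt}_>(G)$. **Lemma.**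 Let $I\unlhd R[\![t]\!][\mathbf x]$ be an $\mathbf x$-homogeneous ideal, and let $G$ be an initially reduced standard basis of $I$ with respect to the $t$-local monomial ordering $>$. Then for all $w\in\mathbb R_{<0}\times\mathbb R^n$ $$\operatorname{in}_w(I)=\operatorname{lt}_>(I)\quad\Longleftrightarrow\quad \operatorname{in}_w(g)=\operatorname{lt}_>(g)\ \text{ for all } g\in G.$$ -/

import Mathlib

noncomputable section

namespace MixedGroebner

/-- The mixed power series polynomial ring `R⟦t⟧[x₁, …, xₙ]`. -/
abbrev MixedRing (n : ℕ) (R : Type*) [CommRing R] : Type _ :=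
  MvPolynomial (Fin n) (PowerSeries R)

/-- The polynomial ring `R[t, x₁, …, xₙ]`; the variable with index `0` is `t`, the variable with
index `i + 1` is the `x` with index `i`. -/
abbrev TXPoly (n : ℕ) (R : Type*) [CommRing R] : Type _ :=
  MvPolynomial (Fin (n + 1)) R

/-- Monomials `t ^ β * x ^ α`, through their exponent vectors `(β, α)`: multiplication of
monomials is addition of exponent vectors, the monomial `1` is `0` and `t` is `single 0 1`. -/
abbrev Mon (n : ℕ) : Type := Fin (n + 1) →₀ ℕ

/-- A monomial ordering: a (strict) total ordering `>` on the monomials in `t, x` which is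
compatible with multiplication. It need not be a well-ordering. -/
structure MonomialOrdering (n : ℕ) where
  gt : Mon n → Mon n → Prop
  irrefl : ∀ a, ¬ gt a a
  trans : ∀ a b c, gt a b → gt b c → gt a c
  total : ∀ a b, gt a b ∨ a = b ∨ gt b a
  mul_compat : ∀ a b c, gt a b → gt (a + c) (b + c)

/-- `t`-local: `1 > t`. -/
def MonomialOrdering.IsTLocal {n : ℕ} (ord : MonomialOrdering n) : Prop :=
  ord.gt 0 (Finsupp.single 0 1)

section

variable {n : ℕ} {R : Type*} [CommRing R]

/-- The coefficient of `f ∈ R⟦t⟧[x]` at the monomial `t ^ β * x ^ α` with exponent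
vector `m = (β, α)`. -/
def txCoeff (m : Mon n) (f : MixedRing n R) : R :=
  PowerSeries.coeff (m 0) (MvPolynomial.coeff m.tail f)

/-- The monomials occurring in `f ∈ R⟦t⟧[x]`. -/
def txSupport (f : MixedRing n R) : Set (Mon n) := {m | txCoeff m f ≠ 0}

/-- The term `c * t ^ β * x ^ α` as an element of `R⟦t⟧[x]`, where `m = (β, α)`. -/
def mixedTerm (m : Mon n) (c : R) : MixedRing n R :=
  MvPolynomial.monomial m.tail (PowerSeries.monomial (m 0) c)

/-- `m` is the greatest monomial occurring in `f`. -/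
def IsLeadingMonomial (ord : MonomialOrdering n) (f : MixedRing n R) (m : Mon n) : Prop :=
  m ∈ txSupport f ∧ ∀ m' ∈ txSupport f, m' ≠ m → ord.gt m m'

open Classical in
/-- The leading monomial `lm_>(f)`, set to `1` when there is none (as for `f = 0`). -/
def leadingMonomial (ord : MonomialOrdering n) (f : MixedRing n R) : Mon n :=
  if h : ∃ m, IsLeadingMonomial ord f m then h.choose else 0

/-- The leading coefficient `lc_>(f)`. -/
def leadingCoeff (ord : MonomialOrdering n) (f : MixedRing n R) : R :=
  txCoeff (leadingMonomial ord f) f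

/-- The leading term `lt_>(f) = lc_>(f) * lm_>(f)`, in `R[t, x]`; in particular `lt_>(0) = 0`. -/
def leadingTerm (ord : MonomialOrdering n) (f : MixedRing n R) : TXPoly n R :=
  MvPolynomial.monomial (leadingMonomial ord f) (leadingCoeff ord f)

/-- The tail `f - lt_>(f)`, in `R⟦t⟧[x]`. -/
def tailPart (ord : MonomialOrdering n) (f : MixedRing n R) : MixedRing n R :=
  f - mixedTerm (leadingMonomial ord f) (leadingCoeff ord f)

/-- The ideal `lt_>(H)` of `R[t, x]` generated by the leading terms of the elements of `H`;
for an ideal `H = I` this is the leading ideal of `I`. -/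
def leadingIdeal (ord : MonomialOrdering n) (H : Set (MixedRing n R)) : Ideal (TXPoly n R) :=
  Ideal.span (leadingTerm ord '' H)

/-- The weighted degree `w · (β, α)`. -/
def wDeg (w : Fin (n + 1) → ℝ) (m : Mon n) : ℝ := ∑ i, w i * (m i : ℝ)

/-- The monomials of `f` of maximal weighted degree. -/
def maxSupport (w : Fin (n + 1) → ℝ) (f : MixedRing n R) : Set (Mon n) :=
  {m | m ∈ txSupport f ∧ ∀ m' ∈ txSupport f, wDeg w m' ≤ wDeg w m}

/-- The initial form `in_w(f)`, the sum of the terms of `f` of maximal weighted degree. For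
`w 0 < 0` the sum is finite, see `finite_maxSupport`. -/
def initialForm (w : Fin (n + 1) → ℝ) (f : MixedRing n R) : TXPoly n R :=
  ∑ᶠ m ∈ maxSupport w f, MvPolynomial.monomial m (txCoeff m f)

/-- The initial ideal `in_w(I)` in `R[t, x]`. -/
def initialIdeal (w : Fin (n + 1) → ℝ) (I : Ideal (MixedRing n R)) : Ideal (TXPoly n R) :=
  Ideal.span (initialForm w '' (I : Set (MixedRing n R)))

/-- An ideal of `R⟦t⟧[x]` is `x`-homogeneous if it is generated by `x`-homogeneous elements. -/
def IsXHomogeneousIdeal (I : Ideal (MixedRing n R)) : Prop :=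
  ∃ S : Set (MixedRing n R), (∀ f ∈ S, ∃ d : ℕ, MvPolynomial.IsHomogeneous f d) ∧
    I = Ideal.span S

/-- `G` is a standard basis of `I`: a finite subset of `I` whose leading terms generate the
leading ideal of `I`. -/
def IsStandardBasis (ord : MonomialOrdering n) (I : Ideal (MixedRing n R))
    (G : Finset (MixedRing n R)) : Prop :=
  (G : Set (MixedRing n R)) ⊆ (I : Set (MixedRing n R)) ∧
    leadingIdeal ord (G : Set (MixedRing n R)) = leadingIdeal ord (I : Set (MixedRing n R))

/-- No proper subset of the set of leading terms of `G` generates the leading ideal of `I`. -/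
def IsMinimalFor (ord : MonomialOrdering n) (I : Ideal (MixedRing n R))
    (G : Finset (MixedRing n R)) : Prop :=
  ∀ S : Set (TXPoly n R), S ⊂ leadingTerm ord '' (G : Set (MixedRing n R)) →
    Ideal.span S ≠ leadingIdeal ord (I : Set (MixedRing n R))

/-- `G` is reduced with respect to `H`: no (nonzero) term of the tail of an element of `G` lies
in `lt_>(H)`. -/
def IsReducedWrt (ord : MonomialOrdering n) (G H : Set (MixedRing n R)) : Prop :=
  ∀ g ∈ G, ∀ m ∈ txSupport (tailPart ord g),
    MvPolynomial.monomial m (txCoeff m (tailPart ord g)) ∉ leadingIdeal ord H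

/-- For `g = ∑ g_α * x ^ α` with `g_α ∈ R⟦t⟧`, the element `∑ lt_>(g_α) * x ^ α`. -/
def lowestTerms (ord : MonomialOrdering n) (g : MixedRing n R) : MixedRing n R :=
  ∑ α ∈ g.support,
    mixedTerm (leadingMonomial ord (MvPolynomial.C (MvPolynomial.coeff α g) : MixedRing n R))
      (leadingCoeff ord (MvPolynomial.C (MvPolynomial.coeff α g) : MixedRing n R)) *
      MvPolynomial.monomial α 1

/-- `G` is initially reduced with respect to `H`. -/
def IsInitiallyReducedWrt (ord : MonomialOrdering n) (G H : Set (MixedRing n R)) : Prop :=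
  IsReducedWrt ord (lowestTerms ord '' G) H

/-- `G` is an initially reduced standard basis of `I`: a standard basis that is minimal and
initially reduced with respect to itself. -/
def IsInitiallyReducedStandardBasis (ord : MonomialOrdering n) (I : Ideal (MixedRing n R))
    (G : Finset (MixedRing n R)) : Prop :=
  IsStandardBasis ord I G ∧ IsMinimalFor ord I G ∧
    IsInitiallyReducedWrt ord (G : Set (MixedRing n R)) (G : Set (MixedRing n R))

theorem wDeg_eq (w : Fin (n + 1) → ℝ) (m : Mon n) :
    wDeg w m = w 0 * (m 0 : ℝ) + ∑ i : Fin n, w i.succ * (m.tail i : ℝ) := by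
  simp [wDeg, Fin.sum_univ_succ, Finsupp.tail_apply]

/-- The lowest monomial in `t` occurring in `f` together with `x ^ α`. -/
theorem exists_lowest (f : MixedRing n R) {m : Mon n} (hm : m ∈ txSupport f) :
    m.tail ∈ f.support ∧
      Finsupp.cons (MvPolynomial.coeff m.tail f).order.toNat m.tail ∈ txSupport f ∧
      (MvPolynomial.coeff m.tail f).order.toNat ≤ m 0 := by
  have h0 : MvPolynomial.coeff m.tail f ≠ 0 := by
    intro h
    exact hm (by simp [txCoeff, h])
  refine ⟨MvPolynomial.mem_support_iff.2 h0, ?_, ?_⟩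
  · simpa [txSupport, txCoeff] using PowerSeries.coeff_order h0
  · have h1 := PowerSeries.order_le (m 0) hm
    exact ENat.toNat_le_of_le_natCast h1

/-- For `w 0 < 0` only finitely many terms have maximal weighted degree. -/
theorem finite_maxSupport (w : Fin (n + 1) → ℝ) (hw : w 0 < 0) (f : MixedRing n R) :
    (maxSupport w f).Finite := by
  refine (f.support.finite_toSet.image
    fun α => Finsupp.cons (MvPolynomial.coeff α f).order.toNat α).subset ?_
  rintro m ⟨hm, hmax⟩
  obtain ⟨h1, h2, h3⟩ := exists_lowest f hm
  refine ⟨m.tail, h1, ?_⟩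
  have h4 := hmax _ h2
  rw [wDeg_eq, wDeg_eq] at h4
  simp only [Finsupp.cons_zero, Finsupp.tail_cons] at h4
  have h5 : (m 0 : ℝ) ≤ ((MvPolynomial.coeff m.tail f).order.toNat : ℝ) := by nlinarith
  have h6 : m 0 = (MvPolynomial.coeff m.tail f).order.toNat :=
    le_antisymm (by exact_mod_cast h5) h3
  show Finsupp.cons _ m.tail = m
  rw [← h6, Finsupp.cons_tail]

open Classical in
/-- The coefficients of the initial form. -/
theorem coeff_initialForm (w : Fin (n + 1) → ℝ) (hw : w 0 < 0) (f : MixedRing n R) (m : Mon n) :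
    MvPolynomial.coeff m (initialForm w f) = if m ∈ maxSupport w f then txCoeff m f else 0 := by
  rw [initialForm, finsum_mem_eq_finite_toFinset_sum _ (finite_maxSupport w hw f),
    MvPolynomial.coeff_sum]
  simp [MvPolynomial.coeff_monomial]

/-- For a `t`-local ordering every `f ≠ 0` has a leading monomial. -/
theorem exists_isLeadingMonomial (ord : MonomialOrdering n) (hord : ord.IsTLocal)
    (f : MixedRing n R) (hf : f ≠ 0) : ∃ m, IsLeadingMonomial ord f m := by
  have hpow : ∀ (a : Mon n) (k : ℕ), ord.gt a (a + Finsupp.single 0 (k + 1)) := by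
    intro a k
    induction k with
    | zero => simpa [add_comm] using ord.mul_compat _ _ a hord
    | succ k ih =>
      refine ord.trans _ _ _ ih ?_
      have := ord.mul_compat _ _ (a + Finsupp.single 0 (k + 1)) hord
      rw [zero_add] at this
      convert this using 1
      rw [Finsupp.single_add _ (k + 1) 1]
      abel
  have hmax : ∀ T : Finset (Mon n), T.Nonempty → ∃ m ∈ T, ∀ m' ∈ T, m' ≠ m → ord.gt m m' := by
    intro T hT
    induction hT using Finset.Nonempty.cons_induction with
    | singleton a => exact ⟨a, by simp, by simp⟩
    | cons a T ha hT ih =>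
      obtain ⟨m, hm, hmm⟩ := ih
      rcases ord.total a m with h | h | h
      · refine ⟨a, by simp, fun m' hm' hne => ?_⟩
        rcases Finset.mem_cons.1 hm' with rfl | hm'
        · exact absurd rfl hne
        · by_cases he : m' = m
          · exact he ▸ h
          · exact ord.trans _ _ _ h (hmm _ hm' he)
      · exact absurd (h ▸ hm) ha
      · refine ⟨m, by simp [hm], fun m' hm' hne => ?_⟩
        rcases Finset.mem_cons.1 hm' with rfl | hm'
        · exact h
        · exact hmm _ hm' hne
  classical
  obtain ⟨α, hα⟩ : f.support.Nonempty := by simpa using hf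
  obtain ⟨m, hm, hmm⟩ := hmax (f.support.image
    fun α => Finsupp.cons (MvPolynomial.coeff α f).order.toNat α) ⟨_, Finset.mem_image_of_mem _ hα⟩
  obtain ⟨γ, hγ, rfl⟩ := Finset.mem_image.1 hm
  refine ⟨Finsupp.cons (MvPolynomial.coeff γ f).order.toNat γ, ?_, fun m' hm' hne => ?_⟩
  · simpa [txSupport, txCoeff] using PowerSeries.coeff_order (MvPolynomial.mem_support_iff.1 hγ)
  · obtain ⟨h1, -, h3⟩ := exists_lowest f hm'
    have h4 := hmm _ (Finset.mem_image_of_mem _ h1)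
    by_cases he : Finsupp.cons (MvPolynomial.coeff m'.tail f).order.toNat m'.tail = m'
    · rw [he] at h4
      exact h4 hne
    · obtain ⟨k, hk⟩ := Nat.exists_eq_add_of_le h3
      have hk' : m' = Finsupp.cons (MvPolynomial.coeff m'.tail f).order.toNat m'.tail +
          Finsupp.single 0 k := by
        conv_lhs => rw [← Finsupp.cons_tail m', hk]
        ext i
        refine Fin.cases ?_ (fun j => ?_) i
        · simp
        · simp
      cases k with
      | zero => exact absurd (by simpa using hk'.symm) he
      | succ k =>
        have h5 := hpow (Finsupp.cons (MvPolynomial.coeff m'.tail f).order.toNat m'.tail) k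
        rw [← hk'] at h5
        by_cases he2 : Finsupp.cons (MvPolynomial.coeff m'.tail f).order.toNat m'.tail =
            Finsupp.cons (MvPolynomial.coeff γ f).order.toNat γ
        · rwa [he2] at h5
        · exact ord.trans _ _ _ (h4 he2) h5

theorem isLeadingMonomial_unique (ord : MonomialOrdering n) (f : MixedRing n R) {m m' : Mon n}
    (h : IsLeadingMonomial ord f m) (h' : IsLeadingMonomial ord f m') : m = m' := by
  by_contra hne
  exact ord.irrefl _ (ord.trans _ _ _ (h.2 _ h'.1 (Ne.symm hne)) (h'.2 _ h.1 hne))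

theorem leadingMonomial_eq (ord : MonomialOrdering n) (f : MixedRing n R) {m : Mon n}
    (h : IsLeadingMonomial ord f m) : leadingMonomial ord f = m := by
  have hex : ∃ m, IsLeadingMonomial ord f m := ⟨m, h⟩
  rw [leadingMonomial, dif_pos hex]
  exact isLeadingMonomial_unique ord f hex.choose_spec h

end

end MixedGroebner

end

open MixedGroebner

/-! Since `w 0 < 0`, a term of maximal weight carries the lowest power of `t` that occurs beside its
`x ^ α`. If `in_w(I) = lt(I)`, then for `g ∈ G` the form `in_w(g)` lies in `lt(G)`, an ideal
generated by terms, which therefore contains each term of `in_w(g)`. These are all terms of `g'`,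
and initial reducedness leaves only the leading one (`initialForm_eq_leadingTerm_of_forall`).

Conversely, let `in_w(g) = lt(g)` on `G`; then `lt(I) ⊆ in_w(I)` is immediate. For the other
inclusion take `m` of maximal weight in `f ∈ I`, and pass to the homogeneous component of `f` of the
`x`-degree of `m`. Division by components of the `g`, by decreasing weight instead of along `>`,
yields a remainder in `I` with no nonzero term in `lt(I)`, hence zero. Nothing alters the
coefficient at `m` before `m` is treated, so its term would survive in the remainder unless it lay
in `lt(G)` (`exists_division`, `monomial_mem_leadingIdeal_of_mem_maxSupport`). The infinite division
makes sense because in a fixed `x`-degree only finitely many monomials exceed a given weight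
(`wellFounded_above`). -/

namespace MixedGroebner

section

variable {n : ℕ} {R : Type*} [CommRing R]

/-! ### Coefficients in `R⟦t⟧[x]`. -/

theorem finsupp_tail_add (a b : Mon n) : (a + b).tail = a.tail + b.tail := by
  ext i; simp [Finsupp.tail_apply]

@[simp] theorem txCoeff_zero (m : Mon n) : txCoeff m (0 : MixedRing n R) = 0 := by
  simp [txCoeff]

theorem txCoeff_sub (m : Mon n) (f g : MixedRing n R) :
    txCoeff m (f - g) = txCoeff m f - txCoeff m g := by
  simp [txCoeff]

theorem txCoeff_sum {ι : Type*} (s : Finset ι) (m : Mon n) (f : ι → MixedRing n R) :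
    txCoeff m (∑ i ∈ s, f i) = ∑ i ∈ s, txCoeff m (f i) := by
  simp [txCoeff, MvPolynomial.coeff_sum]

theorem txCoeff_mul (m : Mon n) (f g : MixedRing n R) :
    txCoeff m (f * g) = ∑ p ∈ Finset.HasAntidiagonal.antidiagonal m, txCoeff p.1 f * txCoeff p.2 g := by
  simp only [txCoeff, MvPolynomial.coeff_mul, map_sum, PowerSeries.coeff_mul]
  rw [← Finset.sum_product']
  refine Finset.sum_bij' (fun p _ => (Finsupp.cons p.2.1 p.1.1, Finsupp.cons p.2.2 p.1.2))
    (fun p _ => ((p.1.tail, p.2.tail), (p.1 0, p.2 0))) ?_ ?_ ?_ ?_ ?_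
  · rintro ⟨⟨a, b⟩, c, d⟩ h
    simp only [Finset.mem_product, Finset.HasAntidiagonal.mem_antidiagonal] at h ⊢
    ext i
    refine Fin.cases ?_ (fun j => ?_) i
    · simpa using h.2
    · simpa [Finsupp.tail_apply] using DFunLike.congr_fun h.1 j
  · rintro ⟨a, b⟩ h
    simp only [Finset.mem_product, Finset.HasAntidiagonal.mem_antidiagonal] at h ⊢
    subst h
    exact ⟨(finsupp_tail_add a b).symm, rfl⟩
  · rintro ⟨⟨a, b⟩, c, d⟩ _
    simp
  · rintro ⟨a, b⟩ _
    simp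
  · rintro ⟨⟨a, b⟩, c, d⟩ _
    simp

open Classical in
theorem txCoeff_mixedTerm (m k : Mon n) (c : R) :
    txCoeff m (mixedTerm k c) = if m = k then c else 0 := by
  have h : m = k ↔ k.tail = m.tail ∧ m 0 = k 0 := by
    refine ⟨by rintro rfl; simp, fun h => ?_⟩
    rw [← Finsupp.cons_tail m, ← Finsupp.cons_tail k, h.1, h.2]
  simp only [txCoeff, mixedTerm, MvPolynomial.coeff_monomial, h]
  by_cases h1 : k.tail = m.tail <;> simp [h1, PowerSeries.coeff_monomial]

/-- An element of `R⟦t⟧[x]` with prescribed coefficients. -/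
theorem exists_txCoeff_eq (φ : Mon n → R) (s : Finset (Fin n →₀ ℕ))
    (hs : ∀ m, φ m ≠ 0 → m.tail ∈ s) : ∃ f : MixedRing n R, ∀ m, txCoeff m f = φ m := by
  classical
  refine ⟨∑ α ∈ s, MvPolynomial.monomial α (PowerSeries.mk fun β => φ (Finsupp.cons β α)),
    fun m => ?_⟩
  simp only [txCoeff, MvPolynomial.coeff_sum, MvPolynomial.coeff_monomial, Finset.sum_ite_eq']
  split_ifs with h
  · simp [Finsupp.cons_tail]
  · simpa using (not_imp_comm.1 (hs m) h).symm

/-! ### Weighted degree in a fixed `x`-degree. -/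

theorem wDeg_add (w : Fin (n + 1) → ℝ) (a b : Mon n) : wDeg w (a + b) = wDeg w a + wDeg w b := by
  simp [wDeg, mul_add, Finset.sum_add_distrib]

/-- There are finitely many `α` of degree `d`, and for each of them `w 0 < 0` turns the lower bound
on the weight into an upper bound on the power of `t`. -/
theorem finite_wDeg_lt (w : Fin (n + 1) → ℝ) (hw : w 0 < 0) (d : ℕ) (c : ℝ) :
    {m : Mon n | m.tail.degree = d ∧ c < wDeg w m}.Finite := by
  have hfin : {α : Fin n →₀ ℕ | α.degree = d}.Finite :=
    (Finsupp.finite_of_degree_le d).subset fun α h => le_of_eq h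
  refine (hfin.biUnion (t := fun α => (fun β => Finsupp.cons β α) ''
    {β : ℕ | β ≤ ⌈(c - ∑ i : Fin n, w i.succ * (α i : ℝ)) / w 0⌉₊}) fun α _ =>
      (Set.finite_Iic _).image _).subset ?_
  rintro m ⟨h1, h2⟩
  simp only [Set.mem_iUnion]
  refine ⟨m.tail, h1, m 0, ?_, Finsupp.cons_tail m⟩
  rw [wDeg_eq] at h2
  have : (m 0 : ℝ) ≤ (c - ∑ i : Fin n, w i.succ * (m.tail i : ℝ)) / w 0 := by
    rw [le_div_iff_of_neg hw]
    linarith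
  exact_mod_cast this.trans (Nat.le_ceil _)

/-- Equal `x`-degree and larger weighted degree. -/
def Above (w : Fin (n + 1) → ℝ) (m' m : Mon n) : Prop :=
  m'.tail.degree = m.tail.degree ∧ wDeg w m < wDeg w m'

/-- Monomials are ranked by the finite number of monomials above them. If `a` is above `b`,
everything above `a` is above `b`, and `a` itself is counted only for `b`. -/
theorem wellFounded_above (w : Fin (n + 1) → ℝ) (hw : w 0 < 0) :
    WellFounded (Above w : Mon n → Mon n → Prop) := by
  refine Subrelation.wf (r := InvImage (· < ·) fun m : Mon n =>
    {m' : Mon n | m'.tail.degree = m.tail.degree ∧ wDeg w m < wDeg w m'}.ncard) ?_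
    (InvImage.wf _ Nat.lt_wfRel.wf)
  intro a b h
  refine Set.ncard_lt_ncard ⟨?_, fun hsub => ?_⟩ (finite_wDeg_lt w hw _ _)
  · exact fun x hx => ⟨hx.1.trans h.1, h.2.trans hx.2⟩
  · exact lt_irrefl _ (hsub (a := a) ⟨h.1, h.2⟩).2

/-! ### Division along the weight. -/

/-- Division with remainder by `x`-homogeneous elements `g i` whose term at `μ i` has strictly
greater weighted degree than all others. The function `A` prescribes the multiple of `g i` that is
subtracted to treat a coefficient `c` at `m`. -/
theorem exists_division {ι : Type*} [Fintype ι] (w : Fin (n + 1) → ℝ) (hw : w 0 < 0)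
    (g : ι → MixedRing n R) (μ : ι → Mon n)
    (hg : ∀ i v, txCoeff v (g i) ≠ 0 → v ≠ μ i → Above w (μ i) v)
    (A : ι → Mon n → R → R) (hA0 : ∀ i m, A i m 0 = 0)
    (hA : ∀ i m c, ¬ μ i ≤ m → A i m c = 0)
    (f : MixedRing n R) (d : ℕ) (hf : ∀ v, txCoeff v f ≠ 0 → v.tail.degree = d) :
    ∃ (r : MixedRing n R) (e : Mon n → R), f - r ∈ Ideal.span (Set.range g) ∧
      (∀ m, txCoeff m r = e m - ∑ i, A i m (e m) * txCoeff (μ i) (g i)) ∧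
      ∀ m, (∀ m', wDeg w m < wDeg w m' → txCoeff m' f = 0) → e m = txCoeff m f := by
  classical
  -- `e m` is the coefficient left at `m` once the multiples chosen at all monomials above `m` have
  -- been subtracted. The multiple chosen at `p.1 + μ i` has cofactor monomial `p.1` and reaches `m`
  -- through the term of `g i` at `p.2`.
  let F : ∀ m : Mon n, (∀ m', Above w m' m → R) → R := fun m e => txCoeff m f -
    ∑ i, ∑ p ∈ Finset.HasAntidiagonal.antidiagonal m, if h : Above w (p.1 + μ i) m then
      A i (p.1 + μ i) (e _ h) * txCoeff p.2 (g i) else 0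
  let e : Mon n → R := (wellFounded_above w hw).fix F
  have he : ∀ m, e m = txCoeff m f -
      ∑ i, ∑ p ∈ Finset.HasAntidiagonal.antidiagonal m, if Above w (p.1 + μ i) m then
        A i (p.1 + μ i) (e (p.1 + μ i)) * txCoeff p.2 (g i) else 0 := by
    intro m
    rw [show e m = F m fun m' _ => e m' from (wellFounded_above w hw).fix_eq F m]
    simp only [F, dite_eq_ite]
  -- `e` stays in `x`-degree `d`; this is what makes the quotients below polynomial in `x`.
  have hdeg : ∀ m, m.tail.degree ≠ d → e m = 0 := by
    intro m
    induction m using (wellFounded_above w hw).induction with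
    | _ m ih =>
      intro hm
      rw [he, not_imp_comm.1 (hf m) hm, zero_sub, neg_eq_zero]
      refine Finset.sum_eq_zero fun i _ => Finset.sum_eq_zero fun p _ => ?_
      split_ifs with h
      · rw [ih _ h (h.1 ▸ hm), hA0, zero_mul]
      · rfl
  have htop : ∀ m, (∀ m', wDeg w m < wDeg w m' → txCoeff m' f = 0) → e m = txCoeff m f := by
    intro m
    induction m using (wellFounded_above w hw).induction with
    | _ m ih =>
      intro hm
      rw [he, sub_eq_self]
      refine Finset.sum_eq_zero fun i _ => Finset.sum_eq_zero fun p _ => ?_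
      split_ifs with h
      · rw [ih _ h fun m' hm' => hm m' (h.2.trans hm'), hm _ h.2, hA0, zero_mul]
      · rfl
  have hq : ∀ i, ∃ q : MixedRing n R, ∀ u, txCoeff u q = A i (u + μ i) (e (u + μ i)) := by
    intro i
    refine exists_txCoeff_eq _ (Finsupp.finite_of_degree_le d).toFinset fun u hu => ?_
    have h1 : (u + μ i).tail.degree = d := by
      by_contra h
      exact hu (by rw [hdeg _ h, hA0])
    rw [finsupp_tail_add, map_add] at h1
    simp only [Set.Finite.mem_toFinset, Set.mem_ofPred_eq]
    omega
  choose q hq using hq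
  refine ⟨f - ∑ i, q i * g i, e, ?_, fun m => ?_, htop⟩
  · rw [sub_sub_cancel]
    exact Ideal.sum_mem _ fun i _ => Ideal.mul_mem_left _ _ (Ideal.subset_span ⟨i, rfl⟩)
  · rw [txCoeff_sub, txCoeff_sum]
    nth_rw 1 [he m]
    rw [sub_sub, ← Finset.sum_add_distrib]
    congr 1
    refine Finset.sum_congr rfl fun i _ => ?_
    rw [txCoeff_mul]
    -- In the coefficient of `q i * g i` at `m`, the pair with `p.2 = μ i` is the subtraction made
    -- at `m` itself. The other nonzero pairs come from monomials above `m` and are already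
    -- accounted for in `e m`.
    have hsplit : A i m (e m) * txCoeff (μ i) (g i) = ∑ p ∈ Finset.HasAntidiagonal.antidiagonal m,
        if p.2 = μ i then A i (p.1 + μ i) (e (p.1 + μ i)) * txCoeff p.2 (g i) else 0 := by
      by_cases hle : μ i ≤ m
      · rw [Finset.sum_eq_single (m - μ i, μ i)]
        · simp [tsub_add_cancel_of_le hle]
        · rintro ⟨a, b⟩ hp hne
          refine if_neg fun hb => hne ?_
          simp only [Finset.HasAntidiagonal.mem_antidiagonal] at hp hb
          subst hp hb
          simp
        · intro hp
          exact absurd (Finset.HasAntidiagonal.mem_antidiagonal.2 (tsub_add_cancel_of_le hle)) hp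
      · rw [hA i m _ hle, zero_mul]
        refine (Finset.sum_eq_zero fun p hp => if_neg fun hb => hle ?_).symm
        rw [← Finset.HasAntidiagonal.mem_antidiagonal.1 hp, hb]
        exact le_add_self
    rw [hsplit, ← Finset.sum_add_distrib]
    refine Finset.sum_congr rfl fun p hp => ?_
    rw [hq]
    by_cases h1 : p.2 = μ i
    · have h2 : p.1 + μ i = m := by rw [← h1]; exact Finset.HasAntidiagonal.mem_antidiagonal.1 hp
      rw [if_pos h1, if_neg, zero_add]
      exact fun h => lt_irrefl _ (h2 ▸ h.2)
    · rw [if_neg h1, add_zero]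
      split_ifs with h2
      · rfl
      · by_cases h3 : txCoeff p.2 (g i) = 0
        · rw [h3, mul_zero]
        · refine absurd ?_ h2
          have h4 := hg i _ h3 h1
          rw [← Finset.HasAntidiagonal.mem_antidiagonal.1 hp]
          refine ⟨?_, ?_⟩
          · rw [finsupp_tail_add, finsupp_tail_add, map_add, map_add, h4.1]
          · rw [wDeg_add, wDeg_add]
            linarith [h4.2]

/-! ### Ideals generated by terms. -/

/-- Coefficients of elements of an ideal generated by terms. -/
theorem exists_coeff_eq_of_mem_span {σ ι : Type*} [Fintype ι] (μ : ι → σ →₀ ℕ) (c : ι → R)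
    {p : MvPolynomial σ R}
    (hp : p ∈ Ideal.span (Set.range fun i => MvPolynomial.monomial (μ i) (c i))) (m : σ →₀ ℕ) :
    ∃ a : ι → R, (∀ i, ¬ μ i ≤ m → a i = 0) ∧ MvPolynomial.coeff m p = ∑ i, a i * c i := by
  classical
  obtain ⟨q, rfl⟩ := Ideal.mem_span_range_iff_exists_fun.1 hp
  refine ⟨fun i => if μ i ≤ m then MvPolynomial.coeff (m - μ i) (q i) else 0,
    fun i h => if_neg h, ?_⟩
  simp only [MvPolynomial.coeff_sum, MvPolynomial.coeff_mul_monomial', ite_mul, zero_mul]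

/-- Converse to `exists_coeff_eq_of_mem_span`: over a general `R`, a term lies in the ideal exactly
when its coefficient is a combination of those `c i` whose monomial divides it. -/
theorem monomial_mem_span {σ ι : Type*} [Fintype ι] (μ : ι → σ →₀ ℕ) (c : ι → R)
    (m : σ →₀ ℕ) (a : ι → R) (ha : ∀ i, ¬ μ i ≤ m → a i = 0) :
    MvPolynomial.monomial m (∑ i, a i * c i) ∈
      Ideal.span (Set.range fun i => MvPolynomial.monomial (μ i) (c i)) := by
  rw [map_sum]
  refine Ideal.sum_mem _ fun i _ => ?_
  by_cases h : μ i ≤ m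
  · have : MvPolynomial.monomial m (a i * c i) =
        MvPolynomial.monomial (m - μ i) (a i) * MvPolynomial.monomial (μ i) (c i) := by
      rw [MvPolynomial.monomial_mul, tsub_add_cancel_of_le h]
    rw [this]
    exact Ideal.mul_mem_left _ _ (Ideal.subset_span ⟨i, rfl⟩)
  · simp [ha i h]

theorem leadingIdeal_eq_span_range (ord : MonomialOrdering n) (G : Finset (MixedRing n R)) :
    leadingIdeal ord (G : Set (MixedRing n R)) = Ideal.span (Set.range fun g : G =>
      MvPolynomial.monomial (leadingMonomial ord g.1) (leadingCoeff ord g.1)) := by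
  rw [leadingIdeal, Set.image_eq_range]
  rfl

/-- The ideal generated by finitely many leading terms contains the terms of its elements. -/
theorem monomial_coeff_mem_leadingIdeal (ord : MonomialOrdering n) (G : Finset (MixedRing n R))
    {p : TXPoly n R} (hp : p ∈ leadingIdeal ord (G : Set (MixedRing n R))) (m : Mon n) :
    MvPolynomial.monomial m (MvPolynomial.coeff m p) ∈
      leadingIdeal ord (G : Set (MixedRing n R)) := by
  rw [leadingIdeal_eq_span_range] at hp ⊢
  obtain ⟨a, ha, h⟩ := exists_coeff_eq_of_mem_span _ _ hp m
  rw [h]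
  exact monomial_mem_span _ _ m a ha

theorem leadingCoeff_ne_zero (ord : MonomialOrdering n) (hord : ord.IsTLocal)
    {f : MixedRing n R} (hf : f ≠ 0) : leadingCoeff ord f ≠ 0 := by
  obtain ⟨m, hm⟩ := exists_isLeadingMonomial ord hord f hf
  rw [leadingCoeff, leadingMonomial_eq ord f hm]
  exact hm.1

/-- The nonzero leading coefficient appears in `in_w(g)`, so the leading monomial has maximal
weight; another monomial of equal weight would appear as well. -/
theorem wDeg_lt_of_initialForm_eq (ord : MonomialOrdering n) (hord : ord.IsTLocal)
    (w : Fin (n + 1) → ℝ) (hw : w 0 < 0) (g : MixedRing n R)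
    (h : initialForm w g = leadingTerm ord g) {v : Mon n} (hv : txCoeff v g ≠ 0)
    (hne : v ≠ leadingMonomial ord g) : wDeg w v < wDeg w (leadingMonomial ord g) := by
  classical
  have hg : g ≠ 0 := by rintro rfl; simp at hv
  have h1 := congrArg (MvPolynomial.coeff (leadingMonomial ord g)) h
  have h2 := congrArg (MvPolynomial.coeff v) h
  rw [coeff_initialForm w hw, leadingTerm, MvPolynomial.coeff_monomial] at h1 h2
  rw [if_pos rfl] at h1
  rw [if_neg (Ne.symm hne)] at h2
  have h3 : leadingMonomial ord g ∈ maxSupport w g := by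
    by_contra hn
    rw [if_neg hn] at h1
    exact leadingCoeff_ne_zero ord hord hg h1.symm
  refine lt_of_le_of_ne (h3.2 v hv) fun heq => ?_
  rw [if_pos ⟨hv, fun m' hm' => heq ▸ h3.2 m' hm'⟩] at h2
  exact hv h2

/-! ### Homogeneous components and terms of maximal weight. -/

open Classical in
theorem txCoeff_homogeneousComponent (m : Mon n) (d : ℕ) (f : MixedRing n R) :
    txCoeff m (MvPolynomial.homogeneousComponent d f) =
      if m.tail.degree = d then txCoeff m f else 0 := by
  simp only [txCoeff, MvPolynomial.coeff_homogeneousComponent]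
  split_ifs <;> simp

theorem homogeneousComponent_mem {I : Ideal (MixedRing n R)} (hI : IsXHomogeneousIdeal I)
    {f : MixedRing n R} (hf : f ∈ I) (d : ℕ) : MvPolynomial.homogeneousComponent d f ∈ I := by
  obtain ⟨S, hS, rfl⟩ := hI
  let _ := MvPolynomial.gradedAlgebra (σ := Fin n) (R := PowerSeries R)
  have h := Ideal.homogeneous_span
    (MvPolynomial.homogeneousSubmodule (Fin n) (PowerSeries R)) S fun f hf =>
      (hS f hf).imp fun d hd => (MvPolynomial.mem_homogeneousSubmodule d f).2 hd
  have := h d hf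
  rwa [show (DirectSum.decompose (MvPolynomial.homogeneousSubmodule (Fin n) (PowerSeries R)) f d :
    MixedRing n R) = _ from MvPolynomial.decomposition.decompose'_apply f d] at this

/-- If `in_w(g) = lt_>(g)` on a standard basis, the terms of maximal weight of elements of the
ideal lie in the leading ideal. -/
theorem monomial_mem_leadingIdeal_of_mem_maxSupport (ord : MonomialOrdering n)
    (hord : ord.IsTLocal) {I : Ideal (MixedRing n R)} (hI : IsXHomogeneousIdeal I)
    {G : Finset (MixedRing n R)} (hG : IsStandardBasis ord I G)
    (w : Fin (n + 1) → ℝ) (hw : w 0 < 0) (h : ∀ g ∈ G, initialForm w g = leadingTerm ord g)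
    {f : MixedRing n R} (hf : f ∈ I) {m : Mon n} (hm : m ∈ maxSupport w f) :
    MvPolynomial.monomial m (txCoeff m f) ∈ leadingIdeal ord (G : Set (MixedRing n R)) := by
  classical
  set L := leadingIdeal ord (G : Set (MixedRing n R)) with hL
  let μ : G → Mon n := fun g => leadingMonomial ord g.1
  -- This component keeps the leading term, and its monomials share one `x`-degree, as `Above`
  -- requires.
  let g' : G → MixedRing n R := fun g =>
    MvPolynomial.homogeneousComponent (μ g).tail.degree g.1
  have hg'lc : ∀ i, txCoeff (μ i) (g' i) = leadingCoeff ord i.1 := fun i => by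
    rw [txCoeff_homogeneousComponent, if_pos rfl]
    rfl
  have hg' : ∀ i v, txCoeff v (g' i) ≠ 0 → v ≠ μ i → Above w (μ i) v := by
    intro i v hv hne
    rw [txCoeff_homogeneousComponent] at hv
    split_ifs at hv with hd
    · exact ⟨hd.symm, wDeg_lt_of_initialForm_eq ord hord w hw i.1 (h i.1 i.2) hv hne⟩
    · exact absurd rfl hv
  -- A term in `L` gets multipliers that cancel it completely; any other term is left alone.
  have hA : ∀ (k : Mon n) (c : R), ∃ a : G → R, (∀ i, ¬ μ i ≤ k → a i = 0) ∧ (c = 0 → a = 0) ∧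
      (MvPolynomial.monomial k c ∈ L → c = ∑ i, a i * leadingCoeff ord i.1) ∧
      (MvPolynomial.monomial k c ∉ L → a = 0) := by
    intro k c
    by_cases hc : c = 0
    · exact ⟨0, by simp, by simp, by simp [hc], by simp⟩
    by_cases hk : MvPolynomial.monomial k c ∈ L
    · have hk' := hk
      rw [hL, leadingIdeal_eq_span_range] at hk'
      obtain ⟨a, ha, hsum⟩ := exists_coeff_eq_of_mem_span _ _ hk' k
      rw [MvPolynomial.coeff_monomial, if_pos rfl] at hsum
      exact ⟨a, ha, fun h => absurd h hc, fun _ => hsum, fun h => absurd hk h⟩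
    · exact ⟨0, by simp, by simp, fun h => absurd h hk, fun _ => rfl⟩
  choose A hA1 hA2 hA3 hA4 using hA
  obtain ⟨r, e, hr, hre, htop⟩ := exists_division w hw g' μ hg' (fun i k c => A k c i)
    (fun i k => by rw [hA2 k 0 rfl]; rfl) (fun i k c => hA1 k c i)
    (MvPolynomial.homogeneousComponent m.tail.degree f) m.tail.degree fun v hv => by
      rw [txCoeff_homogeneousComponent] at hv
      by_contra hd
      exact hv (if_neg hd)
  simp only [hg'lc] at hre
  -- Nothing in `f` lies above the weight of `m`, so the division reaches `m` with its coefficient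
  -- unchanged.
  have hem : e m = txCoeff m f := by
    rw [htop m fun m' hm' => ?_, txCoeff_homogeneousComponent, if_pos rfl]
    rw [txCoeff_homogeneousComponent]
    split_ifs
    · by_contra hne
      exact absurd (hm.2 m' hne) (not_le.2 hm')
    · rfl
  have hrL : ∀ k, MvPolynomial.monomial k (txCoeff k r) ∈ L → txCoeff k r = 0 := by
    intro k hk
    by_cases hkL : MvPolynomial.monomial k (e k) ∈ L
    · rw [hre, ← hA3 k _ hkL, sub_self]
    · rw [hre, hA4 k _ hkL] at hk
      simp [hkL] at hk
  have hrI : r ∈ I := by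
    have hspan : Ideal.span (Set.range g') ≤ I := Ideal.span_le.2 (by
      rintro _ ⟨i, rfl⟩
      exact homogeneousComponent_mem hI (hG.1 i.2) _)
    have := I.sub_mem (homogeneousComponent_mem hI hf m.tail.degree) (hspan hr)
    rwa [sub_sub_cancel] at this
  -- A nonzero `r ∈ I` would have its leading term in `lt(I) = L`, which `hrL` forbids.
  have hr0 : r = 0 := by
    by_contra hne
    refine leadingCoeff_ne_zero ord hord hne (hrL _ ?_)
    rw [hL, hG.2]
    exact Ideal.subset_span ⟨r, hrI, rfl⟩
  by_contra hcon
  have h1 := hre m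
  rw [hem, hA4 m _ hcon, hr0, txCoeff_zero] at h1
  exact hm.1 (by simpa using h1.symm)

/-! ### Lowest powers of `t`: leading terms, `g'` and initial forms. -/

theorem gt_add_single (ord : MonomialOrdering n) (hord : ord.IsTLocal) (a : Mon n) (k : ℕ) :
    ord.gt a (a + Finsupp.single 0 (k + 1)) := by
  induction k with
  | zero => simpa [add_comm] using ord.mul_compat _ _ a hord
  | succ k ih =>
    refine ord.trans _ _ _ ih ?_
    have := ord.mul_compat _ _ (a + Finsupp.single 0 (k + 1)) hord
    rw [zero_add] at this
    convert this using 1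
    rw [Finsupp.single_add _ (k + 1) 1]
    abel

theorem gt_cons (ord : MonomialOrdering n) (hord : ord.IsTLocal) (α : Fin n →₀ ℕ) {a b : ℕ}
    (h : a < b) : ord.gt (Finsupp.cons a α) (Finsupp.cons b α) := by
  obtain ⟨k, rfl⟩ := Nat.exists_eq_add_of_lt h
  convert gt_add_single ord hord (Finsupp.cons a α) k using 1
  ext i
  refine Fin.cases ?_ (fun j => ?_) i <;> simp [add_assoc]

open Classical in
theorem txCoeff_C (m : Mon n) (s : PowerSeries R) :
    txCoeff m (MvPolynomial.C s : MixedRing n R) =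
      if m.tail = 0 then PowerSeries.coeff (m 0) s else 0 := by
  simp only [txCoeff, MvPolynomial.coeff_C, eq_comm (a := (0 : Fin n →₀ ℕ))]
  split_ifs <;> simp

theorem leadingMonomial_C (ord : MonomialOrdering n) (hord : ord.IsTLocal) {s : PowerSeries R}
    (hs : s ≠ 0) : leadingMonomial ord (MvPolynomial.C s : MixedRing n R) =
      Finsupp.cons s.order.toNat 0 := by
  classical
  refine leadingMonomial_eq ord _ ⟨?_, fun m' hm' hne => ?_⟩
  · simpa [txSupport, txCoeff_C] using PowerSeries.coeff_order hs
  · simp only [txSupport, txCoeff_C, Set.mem_ofPred_eq, ne_eq, ite_eq_right_iff,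
      Classical.not_imp] at hm'
    have h1 : m' = Finsupp.cons (m' 0) 0 := by rw [← hm'.1, Finsupp.cons_tail]
    rw [h1] at hne ⊢
    refine gt_cons ord hord 0 (lt_of_le_of_ne ?_ fun h => hne (by rw [h]))
    exact ENat.toNat_le_of_le_natCast (PowerSeries.order_le _ hm'.2)

theorem mixedTerm_mul_monomial (m : Mon n) (c : R) (α : Fin n →₀ ℕ) :
    mixedTerm m c * MvPolynomial.monomial α 1 = mixedTerm (m + Finsupp.cons 0 α) c := by
  simp [mixedTerm, MvPolynomial.monomial_mul, finsupp_tail_add]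

/-- The coefficients of `lowestTerms g`: for every `α`, only the lowest term of `g_α` is kept. -/
theorem txCoeff_lowestTerms (ord : MonomialOrdering n) (hord : ord.IsTLocal) (g : MixedRing n R)
    (m : Mon n) : txCoeff m (lowestTerms ord g) =
      if m 0 = (MvPolynomial.coeff m.tail g).order.toNat then txCoeff m g else 0 := by
  classical
  have hterm : ∀ α ∈ g.support, txCoeff m (mixedTerm
      (leadingMonomial ord (MvPolynomial.C (MvPolynomial.coeff α g) : MixedRing n R))
      (leadingCoeff ord (MvPolynomial.C (MvPolynomial.coeff α g) : MixedRing n R)) *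
      MvPolynomial.monomial α 1) = if α = m.tail then
        if m 0 = (MvPolynomial.coeff α g).order.toNat then txCoeff m g else 0 else 0 := by
    intro α hα
    have h0 := MvPolynomial.mem_support_iff.1 hα
    have hcons : Finsupp.cons (MvPolynomial.coeff α g).order.toNat 0 + Finsupp.cons 0 α =
        Finsupp.cons (MvPolynomial.coeff α g).order.toNat α := by
      ext i
      refine Fin.cases ?_ (fun j => ?_) i <;> simp
    rw [mixedTerm_mul_monomial, txCoeff_mixedTerm, leadingCoeff, leadingMonomial_C ord hord h0,
      hcons, txCoeff_C, if_pos (Finsupp.tail_cons _ _), Finsupp.cons_zero, ← ite_and]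
    by_cases h : α = m.tail ∧ m 0 = (MvPolynomial.coeff α g).order.toNat
    · obtain ⟨rfl, h2⟩ := h
      rw [if_pos (by rw [← h2, Finsupp.cons_tail]), if_pos ⟨rfl, h2⟩, ← h2]
      rfl
    · rw [if_neg h, if_neg fun hm => h ?_]
      rw [hm]
      simp
  rw [lowestTerms, txCoeff_sum, Finset.sum_congr rfl hterm, Finset.sum_ite_eq']
  split_ifs with h1 h2 h2
  · rfl
  · rfl
  · rw [txCoeff, MvPolynomial.notMem_support_iff.1 h1, map_zero]
  · rfl

/-- For fixed `x ^ α`, raising the power of `t` makes a monomial smaller, so the leading term of `g`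
survives in `lowestTerms`. -/
theorem leadingMonomial_eq_order (ord : MonomialOrdering n) (hord : ord.IsTLocal)
    {g : MixedRing n R} {m : Mon n} (hm : IsLeadingMonomial ord g m) :
    m 0 = (MvPolynomial.coeff m.tail g).order.toNat := by
  obtain ⟨-, h2, h3⟩ := exists_lowest g hm.1
  by_contra hne
  have hlt := lt_of_le_of_ne h3 (Ne.symm hne)
  have h4 := gt_cons ord hord m.tail hlt
  rw [Finsupp.cons_tail] at h4
  refine ord.irrefl _ (ord.trans _ _ _ h4 (hm.2 _ h2 fun h => ?_))
  rw [h] at h4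
  exact ord.irrefl _ h4

theorem leadingMonomial_lowestTerms (ord : MonomialOrdering n) (hord : ord.IsTLocal)
    {g : MixedRing n R} (hg : g ≠ 0) :
    leadingMonomial ord (lowestTerms ord g) = leadingMonomial ord g := by
  obtain ⟨m, hm⟩ := exists_isLeadingMonomial ord hord g hg
  rw [leadingMonomial_eq ord g hm]
  refine leadingMonomial_eq ord _ ⟨?_, fun m' hm' hne => hm.2 m' ?_ hne⟩
  · simp only [txSupport, txCoeff_lowestTerms ord hord, Set.mem_ofPred_eq,
      if_pos (leadingMonomial_eq_order ord hord hm)]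
    exact hm.1
  · simp only [txSupport, txCoeff_lowestTerms ord hord, Set.mem_ofPred_eq] at hm' ⊢
    exact fun h => hm' (by simp [h])

/-- The weight analogue, from `w 0 < 0`: all terms of `in_w(g)` survive in `lowestTerms`. -/
theorem eq_order_of_mem_maxSupport (w : Fin (n + 1) → ℝ) (hw : w 0 < 0) {g : MixedRing n R}
    {m : Mon n} (hm : m ∈ maxSupport w g) :
    m 0 = (MvPolynomial.coeff m.tail g).order.toNat := by
  obtain ⟨-, h2, h3⟩ := exists_lowest g hm.1
  refine le_antisymm ?_ h3
  have h4 := hm.2 _ h2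
  rw [wDeg_eq, wDeg_eq] at h4
  simp only [Finsupp.cons_zero, Finsupp.tail_cons] at h4
  have h5 : (m 0 : ℝ) ≤ ((MvPolynomial.coeff m.tail g).order.toNat : ℝ) := by nlinarith
  exact_mod_cast h5

/-- A nonzero element has a monomial of maximal weight. -/
theorem maxSupport_nonempty (w : Fin (n + 1) → ℝ) (hw : w 0 < 0) {g : MixedRing n R}
    (hg : g ≠ 0) : (maxSupport w g).Nonempty := by
  have hne : g.support.Nonempty := by simpa using hg
  obtain ⟨α, hα, hmax⟩ := g.support.exists_max_image
    (fun α => wDeg w (Finsupp.cons (MvPolynomial.coeff α g).order.toNat α)) hne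
  refine ⟨Finsupp.cons (MvPolynomial.coeff α g).order.toNat α, ?_, fun m' hm' => ?_⟩
  · simpa [txSupport, txCoeff] using PowerSeries.coeff_order (MvPolynomial.mem_support_iff.1 hα)
  · obtain ⟨h1, -, h3⟩ := exists_lowest g hm'
    refine le_trans ?_ (hmax _ h1)
    rw [wDeg_eq, wDeg_eq]
    simp only [Finsupp.cons_zero, Finsupp.tail_cons]
    have h5 : ((MvPolynomial.coeff m'.tail g).order.toNat : ℝ) ≤ (m' 0 : ℝ) := by
      exact_mod_cast h3
    nlinarith

theorem initialForm_eq_leadingTerm_of_forall (ord : MonomialOrdering n) (hord : ord.IsTLocal)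
    (G : Finset (MixedRing n R)) (w : Fin (n + 1) → ℝ) (hw : w 0 < 0) {g : MixedRing n R}
    (hred : ∀ m ∈ txSupport (tailPart ord (lowestTerms ord g)),
      MvPolynomial.monomial m (txCoeff m (tailPart ord (lowestTerms ord g))) ∉
        leadingIdeal ord (G : Set (MixedRing n R)))
    (hin : initialForm w g ∈ leadingIdeal ord (G : Set (MixedRing n R))) :
    initialForm w g = leadingTerm ord g := by
  classical
  by_cases hg : g = 0
  · subst hg
    have h1 : ∀ m, txCoeff m (0 : MixedRing n R) = 0 := txCoeff_zero
    simp [initialForm, leadingTerm, leadingCoeff, h1]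
  -- Any other monomial of `in_w(g)` would give a term of the tail of `g'` lying in `lt(G)`.
  have hsub : ∀ m ∈ maxSupport w g, m = leadingMonomial ord g := by
    intro m hm
    by_contra hne
    have htail : txCoeff m (tailPart ord (lowestTerms ord g)) = txCoeff m g := by
      rw [tailPart, txCoeff_sub, txCoeff_mixedTerm, leadingMonomial_lowestTerms ord hord hg,
        if_neg hne, sub_zero, txCoeff_lowestTerms ord hord,
        if_pos (eq_order_of_mem_maxSupport w hw hm)]
    refine hred m ?_ ?_
    · rw [txSupport, Set.mem_ofPred_eq, htail]
      exact hm.1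
    · have := monomial_coeff_mem_leadingIdeal ord G hin m
      rwa [coeff_initialForm w hw, if_pos hm, ← htail] at this
  obtain ⟨m₀, hm₀⟩ := maxSupport_nonempty w hw hg
  have hlm : leadingMonomial ord g ∈ maxSupport w g := hsub m₀ hm₀ ▸ hm₀
  ext m
  rw [coeff_initialForm w hw, leadingTerm, MvPolynomial.coeff_monomial]
  by_cases h : leadingMonomial ord g = m
  · subst h
    rw [if_pos hlm, if_pos rfl]
    rfl
  · rw [if_neg h, if_neg fun hm => h (hsub m hm).symm]

end

end MixedGroebner

theorem lemma3p5 {n : ℕ} {R : Type*} [CommRing R] [IsNoetherianRing R]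
    (ord : MonomialOrdering n) (hord : ord.IsTLocal)
    (I : Ideal (MixedRing n R)) (hI : IsXHomogeneousIdeal I)
    (G : Finset (MixedRing n R)) (hG : IsInitiallyReducedStandardBasis ord I G)
    (w : Fin (n + 1) → ℝ) (hw : w 0 < 0) :
    initialIdeal w I = leadingIdeal ord (I : Set (MixedRing n R)) ↔
      ∀ g ∈ G, initialForm w g = leadingTerm ord g := by
  obtain ⟨hstd, -, hred⟩ := hG
  constructor
  · intro h g hg
    refine initialForm_eq_leadingTerm_of_forall ord hord G w hw
      (hred _ (Set.mem_image_of_mem _ hg)) ?_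
    rw [hstd.2, ← h]
    exact Ideal.subset_span ⟨g, hstd.1 hg, rfl⟩
  · intro h
    rw [← hstd.2]
    refine le_antisymm (Ideal.span_le.2 ?_) (Ideal.span_le.2 ?_)
    · rintro _ ⟨f, hf, rfl⟩
      rw [SetLike.mem_coe, initialForm,
        finsum_mem_eq_finite_toFinset_sum _ (finite_maxSupport w hw f)]
      exact Ideal.sum_mem _ fun m hm => monomial_mem_leadingIdeal_of_mem_maxSupport ord hord hI
        hstd w hw h hf ((finite_maxSupport w hw f).mem_toFinset.1 hm)
    · rintro _ ⟨g, hg, rfl⟩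
      rw [← h g hg]
      exact Ideal.subset_span ⟨g, hstd.1 hg, rfl⟩
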